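/- **Definitions.** Let $G_0=(V,E_0)$ and $G_1=(V,E_1)$ be finite graphs on the same vertex set and let $\sigma$ be a permutation of $V$. The *$\sigma$-twist* $G_0\stackrel{\sigma}{\star}G_1$ is the graph with vertex set $V\times\{0,1\}$ and edge set $$\{\{(x,i),(y,i)\} : i\in\{0,1\},\ \{x,y\}\in E_i\}\ \cup\ \{\{(x,0),(\sigma(x),1)\} : x\in V\}.$$ *Random twisted hypercubes* are random graphs $\boldsymbol G_n$ on $\{0,1\}^n$ defined recursively. $\boldsymbol G_0$ is an isolated vertex. A random twisted hypercube of generation $n+1$ is a random graph $$\boldsymbol G_{n+1}=\boldsymbol G_n^0\stackrel{\sigma_n}{\star}\boldsymbol G_n^1,$$ where $\boldsymbol G_n^0$ and $\boldsymbol G_n^1$ are random twisted hypercubes of generation $n$ with an arbitrary joint distribution (for example independent, or identical), and $\sigma_n$ is a uniformly random permutation of $\{0,1\}^n$ independent of the pair $(\boldsymbol G_n^0,\boldsymbol G_n^1)$. **Theorem.** There is an absolute constant $C>0$ such that for every $n\ge 0$ and every random twisted hypercube $\boldsymbol G_n$ of generation $n$, $$\Big|\,\mathbb P\big[\mathrm{Aut}(\boldsymbol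 G_n)=\{\mathrm{Id}\}\big]-1\,\Big|\le C\,n^2\,2^{-n/20}.$$ In other words, $\mathbb P[\mathrm{Aut}(\boldsymbol G_n)=\{\mathrm{Id}\}]=1-O(n^2 2^{-n/20})$, uniformly over the joint distributions of the instances. -/

import Mathlib

open MeasureTheory ProbabilityTheory

namespace TwistedHypercube

/-- The `σ`-twist of two graphs `G₀`, `G₁` on the same vertex set `V`. Its vertex set is `V × Bool`
(`false` is the label `0`, `true` is the label `1`); each of the two halves carries a copy of the
respective graph, and `(x, 0)` is joined to `(σ x, 1)` for every `x`. -/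
def twist {V : Type*} (G₀ G₁ : SimpleGraph V) (σ : Equiv.Perm V) : SimpleGraph (V × Bool) where
  Adj p q :=
    match p, q with
    | (x, false), (y, false) => G₀.Adj x y
    | (x, true), (y, true) => G₁.Adj x y
    | (x, false), (y, true) => y = σ x
    | (x, true), (y, false) => x = σ y
  symm := ⟨by
    rintro ⟨x, _ | _⟩ ⟨y, _ | _⟩ h
    · exact h.symm
    · exact h
    · exact h
    · exact h.symm⟩
  loopless := ⟨by
    rintro ⟨x, _ | _⟩ h
    · exact G₀.loopless.irrefl x h
    · exact G₁.loopless.irrefl x h⟩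

/-- The vertex set `{0,1}ⁿ`, with the last coordinate split off: `{0,1}ⁿ⁺¹ = {0,1}ⁿ × {0,1}`. -/
def Vert : ℕ → Type
  | 0 => Unit
  | n + 1 => Vert n × Bool

/-- The vertex set is finite. -/
instance instFintypeVert : (n : ℕ) → Fintype (Vert n)
  | 0 => inferInstanceAs (Fintype Unit)
  | n + 1 =>
    letI := instFintypeVert n
    inferInstanceAs (Fintype (Vert n × Bool))

/-- Every set of permutations of the finite set `{0,1}ⁿ` is measurable. -/
instance instMeasurableSpacePermVert (n : ℕ) : MeasurableSpace (Equiv.Perm (Vert n)) := ⊤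

/-- `IsRandomTwistedHypercube μ n G`: on the probability space `(Ω, μ)`, the random graph `G` on
`{0,1}ⁿ` is a random twisted hypercube of generation `n`.

For `n = 0` it is an isolated vertex. For `n + 1`, it is the `σ`-twist of two random twisted
hypercubes `G₀`, `G₁` of generation `n`, where `σ` is a uniformly random permutation of `{0,1}ⁿ`
that is independent of the pair `(G₀, G₁)`, that is, of all the permutations of smaller generations
from which `G₀` and `G₁` are built. The joint distribution of `G₀` and `G₁` is arbitrary: they
may be independent, identical (the duplicube), or dependent in any other way. -/
def IsRandomTwistedHypercube {Ω : Type*} [MeasurableSpace Ω] (μ : Measure Ω) :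
    (n : ℕ) → (Ω → SimpleGraph (Vert n)) → Prop
  | 0, G => ∀ ω, G ω = ⊥
  | n + 1, G =>
    ∃ (G₀ G₁ : Ω → SimpleGraph (Vert n)) (σ : Ω → Equiv.Perm (Vert n)),
      IsRandomTwistedHypercube μ n G₀ ∧
      IsRandomTwistedHypercube μ n G₁ ∧
      Measurable σ ∧
      μ.map σ = uniformOn Set.univ ∧
      IndepFun σ (fun ω => (G₀ ω, G₁ ω)) μ ∧
      ∀ ω, G ω = twist (G₀ ω) (G₁ ω) (σ ω)

end TwistedHypercube

/-! The two copies in a twist form a cut whose crossing edges are a perfect matching, and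
automorphisms preserve such perfect cuts. An isoperimetric inequality (`two_pow_le_ncard`) shows
that any other perfect cut splits both copies in equal halves and is respected by `σ`
(`IsPerfectCut.twist_cases`). Hence perfect cuts are few, automorphisms number at most `2 ^ n * n!`,
and a nontrivial one moves at least half of the vertices.

Fix `G₀` and `G₁`. If the twist has a nontrivial automorphism, then `σ` carries a perfect cut of
`G₀` to one of `G₁`, or satisfies `σ a = b σ` with `a ≠ 1`, or satisfies `σ⁻¹ a = b σ`
(`badPerms_subset`). Each condition has few instances, each satisfied by very few permutations, so a
union bound leaves at most a `3 / 2 ^ n` fraction of bad `σ` (`ncard_badPerms_le`). As `σ` is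
independent of the pair, this bounds the probability whatever the joint law of the pair. -/

namespace TwistedHypercube

/-! ### Slices and degrees in a twist -/

section Slices

variable {V : Type*}

/-- The part of a vertex set of a twist that lies in the copy with label `b`. -/
def slice (S : Set (V × Bool)) (b : Bool) : Set V := {x | (x, b) ∈ S}

@[simp] lemma mem_slice {S : Set (V × Bool)} {b : Bool} {x : V} : x ∈ slice S b ↔ (x, b) ∈ S :=
  Iff.rfl

lemma ncard_eq_add_slice [Finite V] (S : Set (V × Bool)) :
    S.ncard = (slice S false).ncard + (slice S true).ncard := by
  have h : S = (fun x => (x, false)) '' slice S false ∪ (fun x => (x, true)) '' slice S true := by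
    ext ⟨x, _ | _⟩ <;> simp
  have hd : Disjoint ((fun x => (x, false)) '' slice S false)
      ((fun x => (x, true)) '' slice S true) := by
    rw [Set.disjoint_left]
    rintro _ ⟨x, _, rfl⟩ ⟨y, _, h⟩
    simp at h
  conv_lhs => rw [h]
  rw [Set.ncard_union_eq hd (Set.toFinite _) (Set.toFinite _),
    Set.ncard_image_of_injective _ (fun a b h => by simpa using h),
    Set.ncard_image_of_injective _ (fun a b h => by simpa using h)]

variable (G₀ G₁ : SimpleGraph V) (σ : Equiv.Perm V)

@[simp] lemma twist_adj_ff {x y : V} :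
    (twist G₀ G₁ σ).Adj (x, false) (y, false) ↔ G₀.Adj x y := Iff.rfl

@[simp] lemma twist_adj_tt {x y : V} :
    (twist G₀ G₁ σ).Adj (x, true) (y, true) ↔ G₁.Adj x y := Iff.rfl

@[simp] lemma twist_adj_ft {x y : V} :
    (twist G₀ G₁ σ).Adj (x, false) (y, true) ↔ y = σ x := Iff.rfl

@[simp] lemma twist_adj_tf {x y : V} :
    (twist G₀ G₁ σ).Adj (x, true) (y, false) ↔ x = σ y := Iff.rfl

open Classical in
lemma ncard_neighbor_twist_false [Finite V] (x : V) (S : Set (V × Bool)) :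
    ((twist G₀ G₁ σ).neighborSet (x, false) ∩ S).ncard =
      (G₀.neighborSet x ∩ slice S false).ncard + if σ x ∈ slice S true then 1 else 0 := by
  rw [ncard_eq_add_slice]
  congr 1
  split_ifs with h
  · rw [Set.ncard_eq_one]
    refine ⟨σ x, ?_⟩
    ext y
    simp only [mem_slice, Set.mem_inter_iff, SimpleGraph.mem_neighborSet, twist_adj_ft,
      Set.mem_singleton_iff]
    exact ⟨fun h => h.1, fun e => ⟨e, e ▸ h⟩⟩
  · rw [Set.ncard_eq_zero]
    ext y
    simp only [mem_slice, Set.mem_inter_iff, SimpleGraph.mem_neighborSet, twist_adj_ft,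
      Set.mem_empty_iff_false, iff_false, not_and]
    rintro rfl
    exact h

open Classical in
lemma ncard_neighbor_twist_true [Finite V] (x : V) (S : Set (V × Bool)) :
    ((twist G₀ G₁ σ).neighborSet (x, true) ∩ S).ncard =
      (G₁.neighborSet x ∩ slice S true).ncard + if σ.symm x ∈ slice S false then 1 else 0 := by
  rw [ncard_eq_add_slice, add_comm]
  congr 1
  split_ifs with h
  · rw [Set.ncard_eq_one]
    refine ⟨σ.symm x, ?_⟩
    ext y
    simp only [mem_slice, Set.mem_inter_iff, SimpleGraph.mem_neighborSet, twist_adj_tf,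
      Set.mem_singleton_iff]
    refine ⟨fun h => by simp [h.1], ?_⟩
    rintro rfl
    exact ⟨by simp, h⟩
  · rw [Set.ncard_eq_zero]
    ext y
    simp only [mem_slice, Set.mem_inter_iff, SimpleGraph.mem_neighborSet, twist_adj_tf,
      Set.mem_empty_iff_false, iff_false, not_and]
    rintro rfl
    simpa using h

/-- Exchanging the two copies in a twist. -/
def twistSwap : twist G₀ G₁ σ ≃g twist G₁ G₀ σ.symm where
  toFun p := (p.1, !p.2)
  invFun p := (p.1, !p.2)
  left_inv p := by simp
  right_inv p := by simp
  map_rel_iff' := by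
    rintro ⟨x, _ | _⟩ ⟨y, _ | _⟩ <;> simp [Equiv.eq_symm_apply, eq_comm]

end Slices

/-! ### Isoperimetry in deterministic twisted hypercubes -/

/-- `G` arises from isolated vertices by `n` rounds of twisting. -/
inductive IsTwistedHypercube : ℕ → ∀ {V : Type}, SimpleGraph V → Prop
  | bot : IsTwistedHypercube 0 (⊥ : SimpleGraph Unit)
  | twist {n : ℕ} {V : Type} {G₀ G₁ : SimpleGraph V} (σ : Equiv.Perm V) :
      IsTwistedHypercube n G₀ → IsTwistedHypercube n G₁ →
        IsTwistedHypercube (n + 1) (TwistedHypercube.twist G₀ G₁ σ)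

namespace IsTwistedHypercube

variable {n : ℕ} {V : Type} {G : SimpleGraph V}

lemma finite (hG : IsTwistedHypercube n G) : Finite V := by
  induction hG with
  | bot => infer_instance
  | twist _ _ _ _ _ => infer_instance

lemma card_eq (hG : IsTwistedHypercube n G) : Nat.card V = 2 ^ n := by
  induction hG with
  | bot => simp
  | twist σ _ _ ih _ => rw [Nat.card_prod, ih]; simp [pow_succ]

/-- A vertex has only one neighbour in the other copy, so if `S` meets both copies each slice has
minimum degree at least `d - 1`, and induction gives `2 ^ (d - 1)` twice. The equality clause later
turns "at most one crossing edge" into "exactly one". -/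
lemma two_pow_le_ncard (hG : IsTwistedHypercube n G) {S : Set V} (hS : S.Nonempty) {d : ℕ}
    (hd : ∀ x ∈ S, d ≤ (G.neighborSet x ∩ S).ncard) :
    2 ^ d ≤ S.ncard ∧ (S.ncard = 2 ^ d → ∀ x ∈ S, (G.neighborSet x ∩ S).ncard = d) := by
  classical
  induction hG generalizing d with
  | bot =>
    obtain ⟨x, hx⟩ := hS
    have h0 : ∀ x, ((⊥ : SimpleGraph (Unit)).neighborSet x ∩ S).ncard = 0 := by
      intro x
      rw [Set.ncard_eq_zero]
      ext y
      simp
    have hd0 : d = 0 := by simpa [h0] using hd x hx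
    subst hd0
    refine ⟨?_, fun _ x _ => h0 x⟩
    rw [pow_zero, Nat.one_le_iff_ne_zero, ne_eq, Set.ncard_eq_zero]
    exact Set.Nonempty.ne_empty ⟨x, hx⟩
  | @twist n V G₀ G₁ σ h₀ h₁ ih₀ ih₁ =>
    have := h₀.finite
    have hcard := ncard_eq_add_slice S
    have hdeg0 : ∀ x, (x, false) ∈ S → d ≤ (G₀.neighborSet x ∩ slice S false).ncard +
        if σ x ∈ slice S true then 1 else 0 := fun x hx => by
      rw [← ncard_neighbor_twist_false G₀ G₁ σ]
      exact hd (x, false) hx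
    have hdeg1 : ∀ x, (x, true) ∈ S → d ≤ (G₁.neighborSet x ∩ slice S true).ncard +
        if σ.symm x ∈ slice S false then 1 else 0 := fun x hx => by
      rw [← ncard_neighbor_twist_true G₀ G₁ σ]
      exact hd (x, true) hx
    rcases (slice S true).eq_empty_or_nonempty with hS1 | hS1
    · simp only [hS1, Set.mem_empty_iff_false, if_false, add_zero] at hdeg0
      have hS0 : (slice S false).Nonempty := by
        obtain ⟨⟨x, _ | _⟩, hx⟩ := hS
        · exact ⟨x, hx⟩
        · exact absurd (show x ∈ slice S true from hx) (by simp [hS1])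
      obtain ⟨i1, i2⟩ := ih₀ hS0 hdeg0
      rw [hcard, hS1, Set.ncard_empty, add_zero]
      refine ⟨i1, fun he => ?_⟩
      rintro ⟨x, _ | _⟩ hx
      · refine (ncard_neighbor_twist_false G₀ G₁ σ x S).trans ?_
        simpa [hS1] using i2 he x hx
      · exact absurd (show x ∈ slice S true from hx) (by simp [hS1])
    rcases (slice S false).eq_empty_or_nonempty with hS0 | hS0
    · simp only [hS0, Set.mem_empty_iff_false, if_false, add_zero] at hdeg1
      obtain ⟨i1, i2⟩ := ih₁ hS1 hdeg1
      rw [hcard, hS0, Set.ncard_empty, zero_add]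
      refine ⟨i1, fun he => ?_⟩
      rintro ⟨x, _ | _⟩ hx
      · exact absurd (show x ∈ slice S false from hx) (by simp [hS0])
      · refine (ncard_neighbor_twist_true G₀ G₁ σ x S).trans ?_
        simpa [hS0] using i2 he x hx
    have p0 : 0 < (slice S false).ncard := (Set.ncard_pos).2 hS0
    have p1 : 0 < (slice S true).ncard := (Set.ncard_pos).2 hS1
    -- For `d = 0` both slices are nonempty, so `S` has at least two points and the equality case is
    -- void.
    rcases d with _ | k
    · refine ⟨by rw [pow_zero]; omega, fun he => ?_⟩
      rw [pow_zero] at he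
      omega
    · obtain ⟨i1, i2⟩ := ih₀ hS0 (d := k) (fun x hx => by
        have := hdeg0 x hx
        split_ifs at this <;> omega)
      obtain ⟨j1, j2⟩ := ih₁ hS1 (d := k) (fun x hx => by
        have := hdeg1 x hx
        split_ifs at this <;> omega)
      rw [hcard, pow_succ]
      refine ⟨by omega, fun he => ?_⟩
      rintro ⟨x, _ | _⟩ hx
      · refine (ncard_neighbor_twist_false G₀ G₁ σ x S).trans ?_
        have e1 := i2 (by omega) x hx
        have e2 := hdeg0 x hx
        split_ifs at e2 ⊢ <;> omega
      · refine (ncard_neighbor_twist_true G₀ G₁ σ x S).trans ?_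
        have e1 := j2 (by omega) x hx
        have e2 := hdeg1 x hx
        split_ifs at e2 ⊢ <;> omega

lemma ncard_neighborSet (hG : IsTwistedHypercube n G) (x : V) : (G.neighborSet x).ncard = n := by
  classical
  induction hG with
  | bot =>
    rw [Set.ncard_eq_zero]
    ext y
    simp
  | @twist n V G₀ G₁ σ h₀ h₁ ih₀ ih₁ =>
    have := h₀.finite
    rw [← Set.inter_univ (SimpleGraph.neighborSet _ _)]
    obtain ⟨x, _ | _⟩ := x
    · have : slice (Set.univ : Set (V × Bool)) false = Set.univ := rfl
      rw [ncard_neighbor_twist_false]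
      simp [this, ih₀]
    · have : slice (Set.univ : Set (V × Bool)) true = Set.univ := rfl
      rw [ncard_neighbor_twist_true]
      simp [this, ih₁]

end IsTwistedHypercube

/-! ### Perfect cuts -/

/-- A cut `(S, Sᶜ)` whose crossing edges form a perfect matching. -/
def IsPerfectCut {V : Type*} (G : SimpleGraph V) (S : Set V) : Prop :=
  ∀ x, ∃! y, G.Adj x y ∧ (y ∈ S ↔ x ∉ S)

namespace IsPerfectCut

variable {V W : Type*} {G : SimpleGraph V}

lemma image {H : SimpleGraph W} {S : Set V} (h : IsPerfectCut G S) (φ : G ≃g H) :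
    IsPerfectCut H (φ '' S) := by
  have key : ∀ y, y ∈ φ '' S ↔ φ.symm y ∈ S := fun y => by
    constructor
    · rintro ⟨x, hx, rfl⟩
      simpa using hx
    · intro hy
      exact ⟨_, hy, by simp⟩
  intro x
  obtain ⟨y, ⟨h1, h2⟩, h3⟩ := h (φ.symm x)
  refine ⟨φ y, ⟨?_, ?_⟩, fun z hz => ?_⟩
  · have := φ.map_adj_iff.2 h1
    simpa using this
  · rw [key, key]
    simpa using h2
  · rw [key, key] at hz
    rw [← h3 (φ.symm z) ⟨φ.symm.map_adj_iff.2 hz.1, hz.2⟩]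
    simp

end IsPerfectCut

/-- The copy with label `0` in a twist. -/
def half (V : Type*) : Set (V × Bool) := {p | p.2 = false}

@[simp] lemma mem_half {V : Type*} {p : V × Bool} : p ∈ half V ↔ p.2 = false := Iff.rfl

lemma isPerfectCut_half {V : Type*} (G₀ G₁ : SimpleGraph V) (σ : Equiv.Perm V) :
    IsPerfectCut (twist G₀ G₁ σ) (half V) := by
  rintro ⟨x, _ | _⟩
  · refine ⟨(σ x, true), by simp, ?_⟩
    rintro ⟨y, _ | _⟩ <;> simp
  · refine ⟨(σ.symm x, false), by simp, ?_⟩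
    rintro ⟨y, _ | _⟩ <;> simp [Equiv.eq_symm_apply, eq_comm]

namespace IsTwistedHypercube

variable {n : ℕ} {V : Type} {G : SimpleGraph V}

lemma two_pow_pred_le_ncard (hG : IsTwistedHypercube n G) {T : Set V} (hT : T.Nonempty)
    (h : ∀ x ∈ T, (G.neighborSet x \ T).Subsingleton) :
    2 ^ (n - 1) ≤ T.ncard ∧
      (T.ncard = 2 ^ (n - 1) → ∀ x ∈ T, (G.neighborSet x \ T).ncard = n - (n - 1)) := by
  have := hG.finite
  have key : ∀ x, (G.neighborSet x ∩ T).ncard + (G.neighborSet x \ T).ncard = n := fun x => by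
    rw [Set.ncard_inter_add_ncard_sdiff_eq_ncard _ _ (Set.toFinite _), hG.ncard_neighborSet]
  obtain ⟨h1, h2⟩ := hG.two_pow_le_ncard hT (d := n - 1) (fun x hx => by
    have a := Set.ncard_le_one_iff_subsingleton.2 (h x hx)
    have := key x
    omega)
  refine ⟨h1, fun he x hx => ?_⟩
  have := h2 he x hx
  have := key x
  omega

/-- Both sides have inner degrees at least `n - 1`, hence at least `2 ^ (n - 1)` points each; as
they share `2 ^ n` points, both are extremal. -/
lemma isPerfectCut_of_subsingleton (hG : IsTwistedHypercube n G) {S : Set V} (hS : S.Nonempty)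
    (hS' : Sᶜ.Nonempty) (h : ∀ x, {y | G.Adj x y ∧ (y ∈ S ↔ x ∉ S)}.Subsingleton) :
    2 * S.ncard = 2 ^ n ∧ IsPerfectCut G S := by
  have := hG.finite
  have hsum : S.ncard + Sᶜ.ncard = 2 ^ n := by rw [Set.ncard_add_ncard_compl, hG.card_eq]
  have e1 : ∀ x ∈ S, G.neighborSet x \ S = {y | G.Adj x y ∧ (y ∈ S ↔ x ∉ S)} := fun x hx => by
    ext y
    simp [hx]
  have e2 : ∀ x ∈ Sᶜ, G.neighborSet x \ Sᶜ = {y | G.Adj x y ∧ (y ∈ S ↔ x ∉ S)} := fun x hx => by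
    have hx : x ∉ S := hx
    ext y
    simp [hx]
  obtain ⟨a1, a2⟩ := hG.two_pow_pred_le_ncard hS (fun x hx => by rw [e1 x hx]; exact h x)
  obtain ⟨b1, b2⟩ := hG.two_pow_pred_le_ncard hS' (fun x hx => by rw [e2 x hx]; exact h x)
  have p0 : 0 < S.ncard := (Set.ncard_pos).2 hS
  have p1 : 0 < Sᶜ.ncard := (Set.ncard_pos).2 hS'
  obtain ⟨m, rfl⟩ : ∃ m, n = m + 1 := by
    rcases n with _ | m
    · rw [pow_zero] at hsum
      omega
    · exact ⟨m, rfl⟩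
  simp only [Nat.add_sub_cancel, Nat.add_sub_cancel_left] at a1 a2 b1 b2
  rw [pow_succ] at hsum ⊢
  refine ⟨by omega, fun x => ?_⟩
  have hone : {y | G.Adj x y ∧ (y ∈ S ↔ x ∉ S)}.ncard = 1 := by
    by_cases hx : x ∈ S
    · rw [← e1 x hx]
      exact a2 (by omega) x hx
    · rw [← e2 x hx]
      exact b2 (by omega) x hx
  obtain ⟨y, hy⟩ := Set.ncard_eq_one.1 hone
  exact ⟨y, by change y ∈ {y | G.Adj x y ∧ (y ∈ S ↔ x ∉ S)}; simp [hy],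
    fun z hz => by change z ∈ {y | G.Adj x y ∧ (y ∈ S ↔ x ∉ S)} at hz; simpa [hy] using hz⟩

end IsTwistedHypercube

/-- A perfect cut of a twist is one of the two copies, or restricts to matching perfect cuts of
both copies. -/
lemma IsPerfectCut.twist_cases {n : ℕ} {V : Type} {G₀ G₁ : SimpleGraph V} {σ : Equiv.Perm V}
    (h₀ : IsTwistedHypercube n G₀) {S : Set (V × Bool)} (hS : IsPerfectCut (twist G₀ G₁ σ) S) :
    S = half V ∨ S = (half V)ᶜ ∨
      (2 * (slice S false).ncard = 2 ^ n ∧ IsPerfectCut G₀ (slice S false) ∧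
        IsPerfectCut G₁ (slice S true) ∧ ∀ x, σ x ∈ slice S true ↔ x ∈ slice S false) := by
  rcases (slice S false).eq_empty_or_nonempty with he | hne
  · right; left
    have h0 : ∀ x, (x, false) ∉ S := fun x hx => by
      have : x ∈ slice S false := hx
      simp [he] at this
    ext ⟨x, _ | _⟩
    · simp [h0]
    · obtain ⟨⟨y, _ | _⟩, ⟨h1, h2⟩, -⟩ := hS (σ.symm x, false)
      · exact absurd (h2.2 (h0 _)) (h0 _)
      · have : y = x := by simpa using h1
        subst this
        simpa using h2.2 (h0 _)
  rcases (slice S false)ᶜ.eq_empty_or_nonempty with he | hne'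
  · left
    have h0 : ∀ x, (x, false) ∈ S := fun x => by
      by_contra hx
      have : x ∈ (slice S false)ᶜ := hx
      simp [he] at this
    ext ⟨x, _ | _⟩
    · simp [h0]
    · obtain ⟨⟨y, _ | _⟩, ⟨h1, h2⟩, -⟩ := hS (σ.symm x, false)
      · exact absurd (h0 _) (h2.1 (h0 _))
      · have : y = x := by simpa using h1
        subst this
        have : (y, true) ∉ S := fun hy => h2.1 hy (h0 _)
        simpa using this
  right; right
  -- A vertex has at most one crossing neighbour inside copy `0`; isoperimetry upgrades this to
  -- exactly one. The matching edge therefore never crosses, which is `hσ`.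
  obtain ⟨hc, hp⟩ := h₀.isPerfectCut_of_subsingleton hne hne' (fun x y hy z hz => by
    have := (hS (x, false)).unique (y₁ := (y, false)) (y₂ := (z, false)) hy hz
    simpa using this)
  have hσ : ∀ x, σ x ∈ slice S true ↔ x ∈ slice S false := fun x => by
    obtain ⟨y, hy, -⟩ := hp x
    by_contra hcon
    have := (hS (x, false)).unique (y₁ := (y, false)) (y₂ := (σ x, true)) hy
      ⟨by simp, by simp only [mem_slice] at hcon; tauto⟩
    simp at this
  refine ⟨hc, hp, fun x => ?_, hσ⟩
  obtain ⟨⟨y, _ | _⟩, ⟨h1, h2⟩, h3⟩ := hS (x, true)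
  · have hx : x = σ y := by simpa using h1
    have := hσ y
    rw [← hx] at this
    simp only [mem_slice] at this
    tauto
  · refine ⟨y, ⟨h1, h2⟩, fun z hz => ?_⟩
    simpa using h3 (z, true) hz

/-- Apart from the two halves, a perfect cut is determined through `σ` by its trace on copy `0`, so
each generation adds at most two. -/
lemma IsTwistedHypercube.ncard_isPerfectCut_le {n : ℕ} {V : Type} {G : SimpleGraph V}
    (hG : IsTwistedHypercube n G) : {S | IsPerfectCut G S}.ncard ≤ 2 * n := by
  induction hG with
  | bot =>
    refine ((Set.ncard_eq_zero (Set.toFinite _)).2 ?_).le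
    ext S
    simp only [Set.mem_ofPred_eq, Set.mem_empty_iff_false, iff_false]
    intro h
    obtain ⟨y, hy, -⟩ := h ()
    simp at hy
  | @twist n V G₀ G₁ σ h₀ h₁ ih₀ ih₁ =>
    have := h₀.finite
    have hsub : {S | IsPerfectCut (TwistedHypercube.twist G₀ G₁ σ) S} ⊆
        {half V, (half V)ᶜ} ∪
          (fun T => {p : V × Bool | (if p.2 then σ.symm p.1 else p.1) ∈ T}) ''
            {S | IsPerfectCut G₀ S} := by
      intro S hS
      rcases IsPerfectCut.twist_cases h₀ hS with h | h | ⟨-, h1, -, h2⟩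
      · simp [h]
      · simp [h]
      · refine Or.inr ⟨slice S false, h1, ?_⟩
        ext ⟨x, _ | _⟩
        · simp
        · have := h2 (σ.symm x)
          simpa using this.symm
    refine (Set.ncard_le_ncard hsub (Set.toFinite _)).trans
      ((Set.ncard_union_le _ _).trans ?_)
    have a : ({half V, (half V)ᶜ} : Set (Set (V × Bool))).ncard ≤ 2 :=
      (Set.ncard_insert_le _ _).trans (by rw [Set.ncard_singleton])
    have b := Set.ncard_image_le (f := fun T => {p : V × Bool |
      (if p.2 then σ.symm p.1 else p.1) ∈ T}) (s := {S | IsPerfectCut G₀ S}) (Set.toFinite _)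
    omega

/-! ### Automorphisms of twists: decomposition, moved points, number -/

/-- An isomorphism of twists that respects the halves splits into isomorphisms of the halves. -/
lemma exists_iso_of_image_half {V : Type*} {G₀ G₁ H₀ H₁ : SimpleGraph V} {σ τ : Equiv.Perm V}
    (φ : twist G₀ G₁ σ ≃g twist H₀ H₁ τ) (hφ : φ '' half V = half V) :
    ∃ (a : G₀ ≃g H₀) (b : G₁ ≃g H₁), (∀ x, φ (x, false) = (a x, false)) ∧
      (∀ x, φ (x, true) = (b x, true)) ∧ ∀ x, τ (a x) = b (σ x) := by
  have key : ∀ p, (φ p).2 = false ↔ p.2 = false := fun p => by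
    rw [← mem_half, ← mem_half, ← hφ, (EquivLike.injective φ).mem_set_image, hφ]
  have key' : ∀ p, (φ.symm p).2 = false ↔ p.2 = false := fun p => by
    rw [← key, RelIso.apply_symm_apply]
  have e : ∀ b x, φ (x, b) = ((φ (x, b)).1, b) := fun b x => by
    refine Prod.ext rfl ?_
    have := key (x, b)
    cases b
    · simpa using this
    · simpa using this
  have e' : ∀ b x, φ.symm (x, b) = ((φ.symm (x, b)).1, b) := fun b x => by
    refine Prod.ext rfl ?_
    have := key' (x, b)
    cases b
    · simpa using this
    · simpa using this
  let f : Bool → V ≃ V := fun b =>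
    { toFun := fun x => (φ (x, b)).1
      invFun := fun x => (φ.symm (x, b)).1
      left_inv := fun x => by
        change (φ.symm ((φ (x, b)).1, b)).1 = x
        rw [← e b x]
        simp
      right_inv := fun x => by
        change (φ ((φ.symm (x, b)).1, b)).1 = x
        rw [← e' b x]
        simp }
  refine ⟨⟨f false, ?_⟩, ⟨f true, ?_⟩, e false, e true, fun x => ?_⟩
  · intro x y
    have := φ.map_adj_iff (v := (x, false)) (w := (y, false))
    rw [e false x, e false y] at this
    exact this
  · intro x y
    have := φ.map_adj_iff (v := (x, true)) (w := (y, true))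
    rw [e true x, e true y] at this
    exact this
  · have := φ.map_adj_iff (v := (x, false)) (w := (σ x, true))
    rw [e false x, e true (σ x)] at this
    exact Eq.symm (this.2 rfl)

/-- An automorphism of a twist that exchanges the halves splits into isomorphisms. -/
lemma exists_iso_of_image_half_eq_compl {V : Type*} {G₀ G₁ : SimpleGraph V} {σ : Equiv.Perm V}
    (φ : twist G₀ G₁ σ ≃g twist G₀ G₁ σ) (hφ : φ '' half V = (half V)ᶜ) :
    ∃ (a : G₀ ≃g G₁) (b : G₁ ≃g G₀), ∀ x, σ.symm (a x) = b (σ x) := by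
  obtain ⟨a, b, -, -, h⟩ := exists_iso_of_image_half (φ.trans (twistSwap G₀ G₁ σ)) (by
    have h1 : (φ.trans (twistSwap G₀ G₁ σ)) '' half V = twistSwap G₀ G₁ σ '' (φ '' half V) := by
      rw [Set.image_image]
      rfl
    rw [h1, hφ]
    ext ⟨x, b⟩
    constructor
    · rintro ⟨⟨y, c⟩, hc, h⟩
      have : (y, !c) = (x, b) := h
      simp only [Prod.mk.injEq] at this
      simp only [Set.mem_compl_iff, mem_half] at hc
      simp [← this.2, hc]
    · intro hb
      have hb : b = false := hb
      exact ⟨(x, true), by simp, by rw [hb]; rfl⟩)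
  exact ⟨a, b, h⟩

namespace IsTwistedHypercube

/-- A nontrivial automorphism moves at least half of the vertices. -/
lemma two_pow_le_ncard_moved {n : ℕ} {V : Type} {G : SimpleGraph V}
    (hG : IsTwistedHypercube n G) (φ : G ≃g G) (hφ : ∃ x, φ x ≠ x) :
    2 ^ n ≤ 2 * {x | φ x ≠ x}.ncard := by
  induction hG with
  | bot =>
    obtain ⟨x, hx⟩ := hφ
    exact absurd rfl hx
  | @twist n V G₀ G₁ σ h₀ h₁ ih₀ ih₁ =>
    have := h₀.finite
    rcases ((isPerfectCut_half G₀ G₁ σ).image φ).twist_cases h₀ with h | h | ⟨hc, -, -, hσ⟩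
    · obtain ⟨a, b, ha, hb, hab⟩ := exists_iso_of_image_half φ h
      -- `σ` conjugates `a` to `b`, so one is trivial only if both are.
      have hne : (∃ x, a x ≠ x) ∧ ∃ x, b x ≠ x := by
        obtain ⟨⟨x, _ | _⟩, hx⟩ := hφ
        · rw [ha] at hx
          have hx : a x ≠ x := fun h => hx (by rw [h])
          exact ⟨⟨x, hx⟩, σ x, fun h => hx (σ.injective ((hab x).trans h))⟩
        · rw [hb] at hx
          have hx : b x ≠ x := fun h => hx (by rw [h])
          refine ⟨⟨σ.symm x, fun h => hx ?_⟩, x, hx⟩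
          have := hab (σ.symm x)
          rw [h] at this
          simpa using this.symm
      have i0 := ih₀ a hne.1
      have i1 := ih₁ b hne.2
      have e0 : slice {x | φ x ≠ x} false = {x | a x ≠ x} := by
        ext x
        simp [ha]
      have e1 : slice {x | φ x ≠ x} true = {x | b x ≠ x} := by
        ext x
        simp [hb]
      rw [ncard_eq_add_slice, e0, e1, pow_succ]
      omega
    · have hall : {x | φ x ≠ x} = Set.univ := by
        ext p
        simp only [Set.mem_ofPred_eq, Set.mem_univ, iff_true]
        intro hp
        have h1 : p ∈ φ '' half V ↔ p ∈ half V := by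
          conv_lhs => rw [← hp]
          exact (EquivLike.injective φ).mem_set_image
        rw [h] at h1
        simp at h1
      rw [hall, Set.ncard_univ, (h₀.twist σ h₁).card_eq]
      omega
    -- A fixed point lies in both or neither of `half V` and its image. The image contains half of
    -- each copy, so `2 ^ (n - 1)` points are moved in each.
    · have key : ∀ p, φ p = p → (p ∈ φ '' half V ↔ p ∈ half V) := fun p hp => by
        conv_lhs => rw [← hp]
        exact (EquivLike.injective φ).mem_set_image
      have e0 : (slice (φ '' half V) false)ᶜ ⊆ slice {x | φ x ≠ x} false := fun x hx hp =>
        hx ((key _ hp).2 rfl)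
      have e1 : slice (φ '' half V) true ⊆ slice {x | φ x ≠ x} true := fun x hx hp => by
        simpa using (key _ hp).1 hx
      have c0 := Set.ncard_le_ncard e0 (Set.toFinite _)
      have c1 := Set.ncard_le_ncard e1 (Set.toFinite _)
      have c2 : (slice (φ '' half V) true).ncard = (slice (φ '' half V) false).ncard := by
        rw [← Set.ncard_image_of_injective (slice (φ '' half V) false) σ.injective]
        congr 1
        ext x
        rw [← σ.apply_symm_apply x, hσ, σ.injective.mem_set_image]
      have c3 := Set.ncard_add_ncard_compl (slice (φ '' half V) false)
      rw [h₀.card_eq] at c3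
      rw [ncard_eq_add_slice, pow_succ]
      omega

/-- The number of automorphisms is at most that of the hypercube. -/
lemma card_aut_le {n : ℕ} {V : Type} {G : SimpleGraph V} (hG : IsTwistedHypercube n G) :
    Nat.card (G ≃g G) ≤ 2 ^ n * n.factorial := by
  classical
  induction hG with
  | bot =>
    have : Subsingleton ((⊥ : SimpleGraph Unit) ≃g (⊥ : SimpleGraph Unit)) :=
      ⟨fun a b => by ext⟩
    simp
  | @twist n V G₀ G₁ σ h₀ h₁ ih₀ ih₁ =>
    have := h₀.finite
    have : Finite (G₀ ≃g G₀) := DFunLike.finite _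
    set H := TwistedHypercube.twist G₀ G₁ σ with hH
    have : Finite (H ≃g H) := DFunLike.finite _
    have := Fintype.ofFinite (H ≃g H)
    -- Two automorphisms with the same image of `half V` differ by one preserving the halves, which
    -- is determined by its restriction to copy `0`. So fibres have at most `|Aut G₀|` elements, and
    -- the images are perfect cuts.
    have hc := Finset.card_le_mul_card_image (f := fun φ : H ≃g H => φ '' half V) Finset.univ
      (2 ^ n * n.factorial) (by
        intro S hS
        simp only [Finset.mem_image, Finset.mem_univ, true_and] at hS
        obtain ⟨ψ, hψ⟩ := hS
        refine le_trans ?_ ih₀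
        have hp : ∀ φ ∈ Finset.univ.filter (fun φ : H ≃g H => φ '' half V = S),
            ∃ a : G₀ ≃g G₀, ∃ b : G₁ ≃g G₁, (∀ x, ψ.symm (φ (x, false)) = (a x, false)) ∧
              (∀ x, ψ.symm (φ (x, true)) = (b x, true)) ∧ ∀ x, σ (a x) = b (σ x) := by
          intro φ hφ
          simp only [Finset.mem_filter, Finset.mem_univ, true_and] at hφ
          refine exists_iso_of_image_half (φ.trans ψ.symm) ?_
          have h1 : (φ.trans ψ.symm) '' half V = ψ.symm '' (φ '' half V) := by
            rw [Set.image_image]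
            rfl
          rw [h1, hφ, ← hψ, Set.image_image]
          simp
        choose! f g hf hg hfg using hp
        have := Fintype.ofFinite (G₀ ≃g G₀)
        rw [Nat.card_eq_fintype_card]
        refine Finset.card_le_card_of_injOn f (fun _ _ => Finset.mem_univ _) ?_
        intro φ hφ φ' hφ' h
        ext1 ⟨x, _ | _⟩
        · refine EquivLike.injective ψ.symm ?_
          have h1 : f φ = f φ' := h
          rw [hf φ hφ, hf φ' hφ', h1]
        · refine EquivLike.injective ψ.symm ?_
          refine (hg φ hφ x).trans (Eq.trans ?_ (hg φ' hφ' x).symm)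
          have a1 := hfg φ hφ (σ.symm x)
          have a2 := hfg φ' hφ' (σ.symm x)
          rw [h, a2] at a1
          rw [σ.apply_symm_apply] at a1
          rw [a1])
    rw [Finset.card_univ] at hc
    rw [Nat.card_eq_fintype_card]
    refine hc.trans ?_
    have him : (Finset.image (fun φ : H ≃g H => φ '' half V) Finset.univ).card ≤ 2 * (n + 1) := by
      refine le_trans ?_ (h₀.twist σ h₁).ncard_isPerfectCut_le
      rw [← Set.ncard_coe_finset]
      refine Set.ncard_le_ncard ?_ (Set.toFinite _)
      intro S hS
      simp only [Finset.coe_image, Finset.coe_univ, Set.image_univ, Set.mem_range] at hS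
      obtain ⟨φ, rfl⟩ := hS
      exact (isPerfectCut_half G₀ G₁ σ).image φ
    calc _ ≤ 2 ^ n * n.factorial * (2 * (n + 1)) := Nat.mul_le_mul_left _ him
      _ = 2 ^ (n + 1) * (n + 1).factorial := by rw [Nat.factorial_succ]; ring

lemma card_iso_le {n : ℕ} {V : Type} {G H : SimpleGraph V} (hG : IsTwistedHypercube n G) :
    Nat.card (G ≃g H) ≤ 2 ^ n * n.factorial := by
  have := hG.finite
  have : Finite (G ≃g G) := DFunLike.finite _
  rcases isEmpty_or_nonempty (G ≃g H) with h | ⟨⟨ψ⟩⟩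
  · simp
  · refine le_trans ?_ hG.card_aut_le
    refine Nat.card_le_card_of_injective (fun φ => φ.trans ψ.symm) fun φ φ' h => ?_
    ext1 x
    have := DFunLike.congr_fun h x
    exact EquivLike.injective ψ.symm this

end IsTwistedHypercube

/-! ### Counting permutations under constraints -/

section Counting

variable {V : Type*} [Finite V]

/-- Permutations that are determined by their values off a set of `r` points make up at most a
`1 / r!` fraction of all permutations. -/
lemma ncard_mul_factorial_le {X : Set (Equiv.Perm V)} {D : Set V}
    (h : ∀ σ ∈ X, ∀ τ ∈ X, (∀ x ∉ D, σ x = τ x) → σ = τ) :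
    X.ncard * D.ncard.factorial ≤ (Nat.card V).factorial := by
  classical
  have hD : D.ncard.factorial = Nat.card (Equiv.Perm D) := by
    rw [Nat.card_perm, Nat.card_coe_set_eq]
  rw [hD, ← Nat.card_coe_set_eq, ← Nat.card_prod, ← Nat.card_perm]
  -- `σ * ρ` agrees with `σ` off `D`, so it determines `σ`, and then `ρ`.
  refine Nat.card_le_card_of_injective
    (fun p : X × Equiv.Perm D => p.1.1 * Equiv.Perm.ofSubtype p.2) ?_
  rintro ⟨⟨σ, hσ⟩, ρ⟩ ⟨⟨τ, hτ⟩, π⟩ he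
  have he : σ * Equiv.Perm.ofSubtype ρ = τ * Equiv.Perm.ofSubtype π := he
  have hst : σ = τ := h σ hσ τ hτ fun x hx => by
    have := DFunLike.congr_fun he x
    simpa [Equiv.Perm.ofSubtype_apply_of_not_mem _ hx] using this
  subst hst
  have := Equiv.Perm.ofSubtype_injective (mul_left_cancel he)
  simp [this]

/-- A third of any set can be chosen so that a permutation maps no chosen point to another one. -/
lemma exists_subset_separated (τ : Equiv.Perm V) (U : Set V) :
    ∃ D ⊆ U, (∀ x ∈ D, τ x ∈ D → τ x = x) ∧ U.ncard ≤ 3 * D.ncard := by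
  obtain ⟨D, hD⟩ := (Set.toFinite {D : Set V | D ⊆ U ∧ ∀ x ∈ D, τ x ∈ D → τ x = x}).exists_maximal
    ⟨∅, by simp⟩
  refine ⟨D, hD.prop.1, hD.prop.2, ?_⟩
  -- A point of `U` outside these three sets could be added to the maximal `D`.
  have hU : U ⊆ D ∪ (τ '' D ∪ τ ⁻¹' D) := by
    intro x hx
    by_contra hcon
    simp only [Set.mem_union, Set.mem_image, Set.mem_preimage, not_or, not_exists, not_and] at hcon
    obtain ⟨h1, h2, h3⟩ := hcon
    refine h1 (hD.le_of_ge (y := insert x D) ⟨Set.insert_subset hx hD.prop.1, ?_⟩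
      (Set.subset_insert _ _) (Set.mem_insert _ _))
    rintro y (rfl | hy) (hz | hz)
    · exact hz
    · exact absurd hz h3
    · exact absurd hz (h2 y hy)
    · exact hD.prop.2 y hy hz
  have h1 := Set.ncard_le_ncard hU (Set.toFinite _)
  have h2 := Set.ncard_union_le D (τ '' D ∪ τ ⁻¹' D)
  have h3 := Set.ncard_union_le (τ '' D) (τ ⁻¹' D)
  have h4 : (τ '' D).ncard = D.ncard := Set.ncard_image_of_injective _ τ.injective
  have h5 : (τ ⁻¹' D).ncard = D.ncard := by
    rw [← Equiv.image_symm_eq_preimage]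
    exact Set.ncard_image_of_injective _ τ.symm.injective
  omega

/-- Few permutations intertwine `a` and `b` if `a` moves many points. -/
lemma ncard_intertwining_le (a b : Equiv.Perm V) {r : ℕ} (hr : 3 * r ≤ {x | a x ≠ x}.ncard) :
    {σ : Equiv.Perm V | ∀ x, σ (a x) = b (σ x)}.ncard * r.factorial ≤
      (Nat.card V).factorial := by
  obtain ⟨D, hDU, hD, hc⟩ := exists_subset_separated a {x | a x ≠ x}
  refine le_trans (Nat.mul_le_mul_left _ (Nat.factorial_le (show r ≤ D.ncard by omega)))
    (ncard_mul_factorial_le ?_)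
  intro σ hσ τ hτ h
  ext y
  by_cases hy : y ∈ D
  -- Points of `D` are moved by `a`, so separation puts `a⁻¹ y` outside `D`, and `σ y = b (σ (a⁻¹
  -- y))` is determined there.
  · have hx : a.symm y ∉ D := fun hx => by
      have h1 := hD _ hx (by simpa using hy)
      exact hDU hx h1
    have h1 := hσ (a.symm y)
    have h2 := hτ (a.symm y)
    rw [h _ hx, ← h2] at h1
    simpa using h1
  · exact h y hy

/-- Few permutations satisfy `σ⁻¹ a = b σ`. -/
lemma ncard_twisted_involution_le (a b : Equiv.Perm V) {r : ℕ} (hr : 3 * r ≤ Nat.card V) :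
    {σ : Equiv.Perm V | ∀ x, σ.symm (a x) = b (σ x)}.ncard * r.factorial ≤
      2 ^ Nat.card V * (Nat.card V).factorial := by
  have hset : Nat.card (Set V) = 2 ^ Nat.card V := by
    have := Fintype.ofFinite V
    rw [Nat.card_eq_fintype_card, Nat.card_eq_fintype_card, Fintype.card_set]
  have := Fintype.ofFinite (Set V)
  -- The separated set belongs to `b σ` and thus depends on `σ`; summing over all candidates `D`
  -- costs the factor `2 ^ |V|`.
  let Y : Set V → Set (Equiv.Perm V) := fun D =>
    {σ | (∀ x, σ.symm (a x) = b (σ x)) ∧ ∀ x ∈ D, b (σ x) ∈ D → b (σ x) = x}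
  have hY : ∀ D ∈ Finset.univ.filter (fun D : Set V => r ≤ D.ncard),
      (Y D).ncard * r.factorial ≤ (Nat.card V).factorial := by
    intro D hD
    simp only [Finset.mem_filter, Finset.mem_univ, true_and] at hD
    refine le_trans (Nat.mul_le_mul_left _ (Nat.factorial_le hD)) (ncard_mul_factorial_le ?_)
    rintro σ ⟨hσ, hσ'⟩ τ ⟨hτ, hτ'⟩ h
    have key : ∀ ρ : Equiv.Perm V, (∀ x, ρ.symm (a x) = b (ρ x)) → ∀ x, ρ (b (ρ x)) = a x := by
      intro ρ hρ x
      rw [← hρ]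
      simp
    ext y
    by_cases hy : y ∈ D
    -- Let `x = (b σ)⁻¹ y`. If `x ∈ D`, separation gives `x = y`, so `σ y = b⁻¹ y`; otherwise `σ x`
    -- is known and `σ y = σ (b (σ x)) = a x`.
    · by_cases hx : σ.symm (b.symm y) ∈ D
      · have h1 := hσ' _ hx (by simpa using hy)
        have h2 : τ.symm (b.symm y) ∈ D := by
          by_contra h2
          have h3 := h _ h2
          rw [Equiv.apply_symm_apply, ← Equiv.eq_symm_apply] at h3
          exact h2 (h3 ▸ hx)
        have h3 := hτ' _ h2 (by simpa using hy)
        simp only [Equiv.apply_symm_apply] at h1 h3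
        have h4 : σ y = b.symm y := by
          conv_lhs => rw [h1]
          simp
        have h5 : τ y = b.symm y := by
          conv_lhs => rw [h3]
          simp
        rw [h4, h5]
      · have h3 := h _ hx
        have h1 := key σ hσ (σ.symm (b.symm y))
        have h2 := key τ hτ (σ.symm (b.symm y))
        rw [← h3] at h2
        rw [← h2] at h1
        simpa using h1
    · exact h y hy
  have hsub : {σ : Equiv.Perm V | ∀ x, σ.symm (a x) = b (σ x)} ⊆
      ⋃ D ∈ Finset.univ.filter (fun D : Set V => r ≤ D.ncard), Y D := by
    intro σ hσ
    obtain ⟨D, -, hD, hc⟩ := exists_subset_separated (σ.trans b) Set.univ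
    rw [Set.ncard_univ] at hc
    simp only [Set.mem_iUnion, Finset.mem_filter, Finset.mem_univ, true_and]
    exact ⟨D, by omega, hσ, hD⟩
  calc _ ≤ (∑ D ∈ Finset.univ.filter (fun D : Set V => r ≤ D.ncard), (Y D).ncard) *
        r.factorial := Nat.mul_le_mul_right _
          ((Set.ncard_le_ncard hsub (Set.toFinite _)).trans (Finset.set_ncard_biUnion_le _ _))
    _ ≤ ∑ D ∈ Finset.univ.filter (fun D : Set V => r ≤ D.ncard), (Nat.card V).factorial := by
      rw [Finset.sum_mul]
      exact Finset.sum_le_sum hY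
    _ ≤ 2 ^ Nat.card V * (Nat.card V).factorial := by
      rw [Finset.sum_const, smul_eq_mul]
      refine Nat.mul_le_mul_right _ ((Finset.card_le_univ _).trans ?_)
      rw [← Nat.card_eq_fintype_card, hset]

/-- The number of permutations that map a given set to another one. -/
lemma ncard_map_set_le (S T : Set V) :
    {σ : Equiv.Perm V | ∀ x, σ x ∈ T ↔ x ∈ S}.ncard ≤
      S.ncard.factorial * (Nat.card V - S.ncard).factorial := by
  classical
  have hf : ∀ A B : Set V, Nat.card (A ≃ B) ≤ A.ncard.factorial := fun A B => by
    rcases isEmpty_or_nonempty (A ≃ B) with h | ⟨⟨e⟩⟩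
    · simp
    · rw [← Nat.card_coe_set_eq, ← Nat.card_perm]
      exact Nat.card_le_card_of_injective (fun f => f.trans e.symm) fun f g h => by
        ext x
        have := DFunLike.congr_fun h x
        exact congrArg Subtype.val (e.symm.injective this)
  have hc : Sᶜ.ncard = Nat.card V - S.ncard := by
    have := Set.ncard_add_ncard_compl S
    omega
  rw [← hc]
  refine le_trans ?_ (Nat.mul_le_mul (hf S T) (hf Sᶜ Tᶜ))
  rw [← Nat.card_prod, ← Nat.card_coe_set_eq]
  have h1 : ∀ σ : {σ : Equiv.Perm V | ∀ x, σ x ∈ T ↔ x ∈ S}, ∀ x, x ∈ S ↔ σ.1 x ∈ T :=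
    fun σ x => (σ.2 x).symm
  have h2 : ∀ σ : {σ : Equiv.Perm V | ∀ x, σ x ∈ T ↔ x ∈ S}, ∀ x, x ∈ Sᶜ ↔ σ.1 x ∈ Tᶜ :=
    fun σ x => not_congr (h1 σ x)
  refine Nat.card_le_card_of_injective
    (fun σ => (σ.1.subtypeEquiv (h1 σ), σ.1.subtypeEquiv (h2 σ))) ?_
  intro σ τ h
  simp only [Prod.mk.injEq] at h
  ext x
  by_cases hx : x ∈ S
  · exact congrArg Subtype.val (DFunLike.congr_fun h.1 ⟨x, hx⟩)
  · exact congrArg Subtype.val (DFunLike.congr_fun h.2 ⟨x, hx⟩)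

end Counting

/-! ### Numerical estimates for the union bound -/

section Estimates

lemma two_pow_le_factorial {m : ℕ} (hm : 64 ≤ m) : 2 ^ (6 * (m - 64)) ≤ m.factorial := by
  calc 2 ^ (6 * (m - 64)) = 64 ^ (m - 64) := by rw [pow_mul]; norm_num
    _ ≤ 65 ^ (m - 64) := Nat.pow_le_pow_left (by norm_num) _
    _ ≤ Nat.factorial 64 * (64 + 1) ^ (m - 64) := Nat.le_mul_of_pos_left _ (Nat.factorial_pos _)
    _ ≤ (64 + (m - 64)).factorial := Nat.factorial_mul_pow_le_factorial
    _ = m.factorial := by rw [Nat.add_sub_cancel' hm]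

lemma quadratic_le_two_pow {n : ℕ} (hn : 12 ≤ n) : 2 * n ^ 2 + 3 * n ≤ 2 ^ (n - 3) := by
  induction n, hn using Nat.le_induction with
  | base => norm_num
  | succ n hn ih =>
    have : n + 1 - 3 = (n - 3) + 1 := by omega
    rw [this, pow_succ _ (n - 3)]
    nlinarith

lemma sq_card_mul_two_pow_le {n : ℕ} (hn : 12 ≤ n) :
    (2 ^ n * n.factorial) ^ 2 * 2 ^ n ≤ 2 ^ 2 ^ (n - 3) := by
  have h1 : n.factorial ≤ 2 ^ (n * n) := by
    rw [pow_mul]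
    exact n.factorial_le_pow.trans (Nat.pow_le_pow_left Nat.lt_two_pow_self.le _)
  calc (2 ^ n * n.factorial) ^ 2 * 2 ^ n ≤ (2 ^ n * 2 ^ (n * n)) ^ 2 * 2 ^ n := by gcongr
    _ = 2 ^ (2 * n ^ 2 + 3 * n) := by
      rw [← pow_add, ← pow_mul, ← pow_add]
      congr 1
      ring
    _ ≤ _ := Nat.pow_le_pow_right (by norm_num) (quadratic_le_two_pow hn)

lemma five_twelve_le {n : ℕ} (hn : 12 ≤ n) : 512 ≤ 2 ^ (n - 3) :=
  (by norm_num : 512 = 2 ^ 9).le.trans (Nat.pow_le_pow_right (by norm_num) (by omega))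

lemma sq_card_mul_two_pow_le_factorial {n : ℕ} (hn : 12 ≤ n) :
    (2 ^ n * n.factorial) ^ 2 * 2 ^ n ≤ (2 ^ (n - 3)).factorial := by
  have h := five_twelve_le hn
  refine (sq_card_mul_two_pow_le hn).trans (le_trans ?_ (two_pow_le_factorial (by omega)))
  exact Nat.pow_le_pow_right (by norm_num) (by omega)

lemma two_pow_eq {n : ℕ} (hn : 12 ≤ n) : 2 ^ n = 8 * 2 ^ (n - 3) := by
  obtain ⟨k, rfl⟩ : ∃ k, n = k + 3 := ⟨n - 3, by omega⟩
  rw [Nat.add_sub_cancel, pow_add]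
  ring

/-- With `r = 2 ^ (n - 3)` the left side is at most `2 ^ (9 * r)`, while `(2 * r)!` is at least `2 ^
(12 * r - 384)`; `r ≥ 512` suffices. -/
lemma sq_card_mul_two_pow_le_factorial' {n : ℕ} (hn : 12 ≤ n) :
    (2 ^ n * n.factorial) ^ 2 * 2 ^ n * 2 ^ 2 ^ n ≤ (2 * 2 ^ (n - 3)).factorial := by
  have h := five_twelve_le hn
  refine (Nat.mul_le_mul_right _ (sq_card_mul_two_pow_le hn)).trans
    (le_trans ?_ (two_pow_le_factorial (by omega)))
  rw [← pow_add, two_pow_eq hn]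
  exact Nat.pow_le_pow_right (by norm_num) (by omega)

/-- The central binomial coefficient, at least `4 ^ M / (2 * M)`, beats the number of pairs of cuts
times `2 ^ n`. -/
lemma sq_mul_factorial_sq_le {n : ℕ} (hn : 12 ≤ n) :
    (2 * n) ^ 2 * ((2 ^ (n - 1)).factorial * (2 ^ (n - 1)).factorial) * 2 ^ n ≤
      (2 ^ n).factorial := by
  set M := 2 ^ (n - 1) with hM
  have hN : 2 ^ n = 2 * M := by
    obtain ⟨k, rfl⟩ : ∃ k, n = k + 1 := ⟨n - 1, by omega⟩
    rw [hM, Nat.add_sub_cancel, pow_succ, mul_comm]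
  have h0 : 0 < M := by positivity
  have h1 := Nat.four_pow_le_two_mul_self_mul_centralBinom M h0
  have h2 : M.centralBinom * (M.factorial * M.factorial) = (2 ^ n).factorial := by
    have := Nat.choose_mul_factorial_mul_factorial (show M ≤ 2 * M by omega)
    rw [show 2 * M - M = M by omega] at this
    rw [hN, ← this, Nat.centralBinom]
    ring
  have h5 := quadratic_le_two_pow hn
  have h6 := two_pow_eq hn
  have h3 : (2 * n) ^ 2 * 2 ^ n * (2 * M) ≤ 4 ^ M := by
    have h4 : (2 * n) ^ 2 ≤ 2 ^ n := by nlinarith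
    rw [← hN, show 4 ^ M = 2 ^ 2 ^ n by rw [hN, pow_mul]; norm_num]
    calc (2 * n) ^ 2 * 2 ^ n * 2 ^ n ≤ 2 ^ n * 2 ^ n * 2 ^ n := by gcongr
      _ = 2 ^ (3 * n) := by ring
      _ ≤ 2 ^ 2 ^ n := Nat.pow_le_pow_right (by norm_num) (by nlinarith)
  have h4 : (2 * n) ^ 2 * 2 ^ n ≤ M.centralBinom := by
    refine Nat.le_of_mul_le_mul_right (h3.trans (h1.trans_eq (mul_comm _ _))) (by omega)
  calc _ = (2 * n) ^ 2 * 2 ^ n * (M.factorial * M.factorial) := by ring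
    _ ≤ M.centralBinom * (M.factorial * M.factorial) := Nat.mul_le_mul_right _ h4
    _ = _ := h2

end Estimates

/-! ### Bad permutations -/

/-- The permutations whose twist has a nontrivial automorphism. -/
def badPerms {V : Type*} (G₀ G₁ : SimpleGraph V) : Set (Equiv.Perm V) :=
  {σ | ∃ φ : twist G₀ G₁ σ ≃g twist G₀ G₁ σ, ∃ p, φ p ≠ p}

/-- The image of `half V` under an automorphism is a perfect cut; its three possible forms give the
three families. -/
lemma badPerms_subset {n : ℕ} {V : Type} {G₀ G₁ : SimpleGraph V}
    (h₀ : IsTwistedHypercube n G₀) :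
    badPerms G₀ G₁ ⊆
      ((⋃ q ∈ {q : Set V × Set V | (IsPerfectCut G₀ q.1 ∧ IsPerfectCut G₁ q.2) ∧
          2 * q.1.ncard = 2 ^ n}, {σ | ∀ x, σ x ∈ q.2 ↔ x ∈ q.1}) ∪
        ⋃ q ∈ {q : (G₀ ≃g G₀) × (G₁ ≃g G₁) | ∃ x, q.1 x ≠ x},
          {σ | ∀ x, σ (q.1.toEquiv x) = q.2.toEquiv (σ x)}) ∪
        ⋃ q ∈ (Set.univ : Set ((G₀ ≃g G₁) × (G₁ ≃g G₀))),
          {σ | ∀ x, σ.symm (q.1.toEquiv x) = q.2.toEquiv (σ x)} := by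
  rintro σ ⟨φ, hφ⟩
  simp only [Set.mem_union, Set.mem_iUnion]
  rcases ((isPerfectCut_half G₀ G₁ σ).image φ).twist_cases h₀ with h | h | ⟨hc, h1, h2, h3⟩
  · obtain ⟨a, b, ha, hb, hab⟩ := exists_iso_of_image_half φ h
    refine Or.inl (Or.inr ⟨(a, b), ?_, hab⟩)
    by_contra hcon
    have ha' : ∀ x, a x = x := by
      intro x
      by_contra hx
      exact hcon ⟨x, hx⟩
    obtain ⟨⟨x, _ | _⟩, hx⟩ := hφ
    · exact hx (by rw [ha, ha'])
    · refine hx ?_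
      rw [hb]
      have := hab (σ.symm x)
      rw [ha', σ.apply_symm_apply] at this
      rw [← this]
  · obtain ⟨a, b, hab⟩ := exists_iso_of_image_half_eq_compl φ h
    exact Or.inr ⟨(a, b), Set.mem_univ _, hab⟩
  · exact Or.inl (Or.inl ⟨(_, _), ⟨⟨h1, h2⟩, hc⟩, h3⟩)

lemma ncard_biUnion_le_mul {ι α : Type*} [Finite ι] [Finite α] (s : Set ι) (f : ι → Set α)
    {c m N : ℕ} (hs : s.ncard ≤ c) (hf : ∀ i ∈ s, c * (f i).ncard * m ≤ N) :
    (⋃ i ∈ s, f i).ncard * m ≤ N := by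
  classical
  have := Fintype.ofFinite ι
  rcases Nat.eq_zero_or_pos c with rfl | hc
  · have : s = ∅ := (Set.ncard_eq_zero (Set.toFinite _)).1 (by omega)
    simp [this]
  have h1 : (⋃ i ∈ s, f i) = ⋃ i ∈ s.toFinset, f i := by simp
  refine Nat.le_of_mul_le_mul_left ?_ hc
  calc c * ((⋃ i ∈ s, f i).ncard * m) ≤ c * ((∑ i ∈ s.toFinset, (f i).ncard) * m) := by
        rw [h1]
        gcongr
        exact Finset.set_ncard_biUnion_le _ _
    _ = ∑ i ∈ s.toFinset, c * (f i).ncard * m := by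
      rw [Finset.sum_mul, Finset.mul_sum]
      exact Finset.sum_congr rfl fun _ _ => by ring
    _ ≤ ∑ i ∈ s.toFinset, N := Finset.sum_le_sum fun i hi => hf i (by simpa using hi)
    _ ≤ c * N := by
      rw [Finset.sum_const, smul_eq_mul, ← Set.ncard_eq_toFinset_card']
      gcongr

/-- For `n ≥ 12` at most a `3 / 2ⁿ` fraction of the permutations is bad. -/
lemma ncard_badPerms_le {n : ℕ} (hn : 12 ≤ n) {V : Type} {G₀ G₁ : SimpleGraph V}
    (h₀ : IsTwistedHypercube n G₀) (h₁ : IsTwistedHypercube n G₁) :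
    (badPerms G₀ G₁).ncard * 2 ^ n ≤ 3 * (Nat.card V).factorial := by
  have := h₀.finite
  have : Finite (G₀ ≃g G₀) := DFunLike.finite _
  have : Finite (G₁ ≃g G₁) := DFunLike.finite _
  have : Finite (G₀ ≃g G₁) := DFunLike.finite _
  have : Finite (G₁ ≃g G₀) := DFunLike.finite _
  have hV := h₀.card_eq
  have hr := two_pow_eq hn
  refine (Nat.mul_le_mul_right _ ((Set.ncard_le_ncard (badPerms_subset h₀) (Set.toFinite _)).trans
    ((Set.ncard_union_le _ _).trans
      (Nat.add_le_add_right (Set.ncard_union_le _ _) _)))).trans ?_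
  rw [add_mul, add_mul, show 3 * (Nat.card V).factorial = (Nat.card V).factorial +
    (Nat.card V).factorial + (Nat.card V).factorial by ring]
  refine Nat.add_le_add (Nat.add_le_add ?_ ?_) ?_
  · refine ncard_biUnion_le_mul (c := (2 * n) ^ 2) _ _ ?_ ?_
    · refine (Set.ncard_le_ncard (t := {S | IsPerfectCut G₀ S} ×ˢ {S | IsPerfectCut G₁ S})
        (fun q hq => hq.1) (Set.toFinite _)).trans ?_
      rw [Set.ncard_prod, pow_two]
      exact Nat.mul_le_mul h₀.ncard_isPerfectCut_le h₁.ncard_isPerfectCut_le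
    · rintro ⟨S, T⟩ ⟨-, hS⟩
      have hM : 2 ^ n = 2 * 2 ^ (n - 1) := by
        obtain ⟨k, rfl⟩ : ∃ k, n = k + 1 := ⟨n - 1, by omega⟩
        rw [Nat.add_sub_cancel, pow_succ, mul_comm]
      have hS : 2 * S.ncard = 2 ^ n := hS
      have h1 := ncard_map_set_le S T
      rw [hV, show S.ncard = 2 ^ (n - 1) by omega,
        show 2 ^ n - 2 ^ (n - 1) = 2 ^ (n - 1) by omega] at h1
      refine le_trans ?_ ((sq_mul_factorial_sq_le hn).trans_eq (by rw [hV]))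
      gcongr
  · refine ncard_biUnion_le_mul (c := (2 ^ n * n.factorial) ^ 2) _ _ ?_ ?_
    · refine (Set.ncard_le_ncard (Set.subset_univ _) (Set.toFinite _)).trans ?_
      rw [Set.ncard_univ, Nat.card_prod, pow_two]
      exact Nat.mul_le_mul h₀.card_aut_le h₁.card_aut_le
    · rintro ⟨a, b⟩ ha
      have hm := h₀.two_pow_le_ncard_moved a ha
      -- At least `2 ^ (n - 1) = 4 * r` points are moved, more than the `3 * r` required.
      have h1 := ncard_intertwining_le (r := 2 ^ (n - 3)) a.toEquiv b.toEquiv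
        (le_trans (by omega) (show 2 ^ n / 2 ≤ {x | a x ≠ x}.ncard by omega))
      refine le_trans (le_trans (le_of_eq ?_)
        (Nat.mul_le_mul_left _ (sq_card_mul_two_pow_le_factorial hn))) h1
      ring
  · refine ncard_biUnion_le_mul (c := (2 ^ n * n.factorial) ^ 2) _ _ ?_ ?_
    · rw [Set.ncard_univ, Nat.card_prod, pow_two]
      exact Nat.mul_le_mul h₀.card_iso_le h₁.card_iso_le
    · rintro ⟨a, b⟩ -
      -- Here every point is available, so `r = 2 ^ n / 4` is allowed; the larger factorial absorbs
      -- `2 ^ |V|`.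
      have h1 := ncard_twisted_involution_le (r := 2 * 2 ^ (n - 3)) a.toEquiv b.toEquiv
        (by omega)
      refine Nat.le_of_mul_le_mul_left ?_ (show 0 < 2 ^ Nat.card V by positivity)
      refine le_trans (le_trans (le_of_eq ?_)
        (Nat.mul_le_mul_left _ (sq_card_mul_two_pow_le_factorial' hn))) h1
      rw [hV]
      ring

/-! ### Measurability and passage to probability -/

instance instMeasurableSingletonClassPermVert (n : ℕ) :
    MeasurableSingletonClass (Equiv.Perm (Vert n)) := ⟨fun _ => trivial⟩

lemma measurableSet_simpleGraph {V : Type*} [Finite V] (S : Set (SimpleGraph V)) :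
    MeasurableSet S := by
  have hS : S = ⋃ g ∈ S, {g} := by simp
  rw [hS]
  refine MeasurableSet.biUnion (Set.to_countable S) fun g _ => ?_
  refine ⟨{g.Adj}, MeasurableSet.singleton _, ?_⟩
  ext h
  simp

variable {Ω : Type*} [MeasurableSpace Ω] {μ : Measure Ω}

namespace IsRandomTwistedHypercube

lemma isTwistedHypercube {n : ℕ} {G : Ω → SimpleGraph (Vert n)}
    (hG : IsRandomTwistedHypercube μ n G) (ω : Ω) : IsTwistedHypercube n (G ω) := by
  induction n with
  | zero =>
    rw [hG ω]
    exact IsTwistedHypercube.bot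
  | succ n ih =>
    obtain ⟨G₀, G₁, σ, h₀, h₁, -, -, -, h⟩ := hG
    rw [h ω]
    exact (ih h₀).twist (σ ω) (ih h₁)

lemma measurableSet_preimage {n : ℕ} {G : Ω → SimpleGraph (Vert n)}
    (hG : IsRandomTwistedHypercube μ n G) (S : Set (SimpleGraph (Vert n))) :
    MeasurableSet (G ⁻¹' S) := by
  induction n with
  | zero =>
    have : G = fun _ => ⊥ := funext hG
    rw [this]
    exact measurable_const (measurableSet_simpleGraph S)
  | succ n ih =>
    obtain ⟨G₀, G₁, σ, h₀, h₁, hσ, -, -, h⟩ := hG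
    have hS : G ⁻¹' S = ⋃ q ∈ {q : (SimpleGraph (Vert n) × SimpleGraph (Vert n)) ×
        Equiv.Perm (Vert n) | twist q.1.1 q.1.2 q.2 ∈ S},
        (G₀ ⁻¹' {q.1.1} ∩ G₁ ⁻¹' {q.1.2}) ∩ σ ⁻¹' {q.2} := by
      ext ω
      simp only [Set.mem_preimage, h ω, Set.mem_iUnion]
      constructor
      · intro hω
        exact ⟨((G₀ ω, G₁ ω), σ ω), hω, ⟨rfl, rfl⟩, rfl⟩
      · rintro ⟨⟨⟨g₀, g₁⟩, s⟩, hq, ⟨e₀, e₁⟩, e⟩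
        simp only [Set.mem_preimage, Set.mem_singleton_iff] at e₀ e₁ e
        rw [e₀, e₁, e]
        exact hq
    rw [hS]
    exact MeasurableSet.biUnion (Set.to_countable _) fun q _ =>
      ((ih h₀ _).inter (ih h₁ _)).inter (hσ (measurableSet_singleton _))

end IsRandomTwistedHypercube

/-- A random permutation that is independent of a random element `X` of a finite type avoids
unlikely sets that depend on `X`. -/
lemma measure_mem_le_of_indepFun [IsProbabilityMeasure μ] {α β : Type*} [Finite α]
    [MeasurableSpace α] [MeasurableSingletonClass α] [MeasurableSpace β]
    {σ : Ω → β} {X : Ω → α} (hX : Measurable X) (hind : IndepFun σ X μ)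
    (B : α → Set β) (hB : ∀ a, MeasurableSet (B a)) {ε : ENNReal}
    (hε : ∀ ω, μ (σ ⁻¹' B (X ω)) ≤ ε) : μ {ω | σ ω ∈ B (X ω)} ≤ ε := by
  have := Fintype.ofFinite α
  have hsub : {ω | σ ω ∈ B (X ω)} ⊆ ⋃ a ∈ Finset.univ, (σ ⁻¹' B a ∩ X ⁻¹' {a}) := by
    intro ω hω
    simp only [Finset.mem_univ, Set.iUnion_true, Set.mem_iUnion]
    exact ⟨X ω, hω, rfl⟩
  have hterm : ∀ a, μ (σ ⁻¹' B a ∩ X ⁻¹' {a}) ≤ ε * μ (X ⁻¹' {a}) := by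
    intro a
    rw [hind.measure_inter_preimage_eq_mul _ _ (hB a) (measurableSet_singleton a)]
    rcases (X ⁻¹' {a}).eq_empty_or_nonempty with he | ⟨ω, hω⟩
    · simp [he]
    · have hω : X ω = a := hω
      gcongr
      exact hω ▸ hε ω
  calc μ {ω | σ ω ∈ B (X ω)} ≤ ∑ a, μ (σ ⁻¹' B a ∩ X ⁻¹' {a}) :=
        (measure_mono hsub).trans (measure_biUnion_finset_le _ _)
    _ ≤ ∑ a, ε * μ (X ⁻¹' {a}) := Finset.sum_le_sum fun a _ => hterm a
    _ = ε * ∑ a, μ (X ⁻¹' {a}) := by rw [Finset.mul_sum]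
    _ = ε := by
      rw [sum_measure_preimage_singleton _ fun a _ => hX (measurableSet_singleton a)]
      simp

lemma measure_exists_aut_le [IsProbabilityMeasure μ] {n : ℕ} (hn : 12 ≤ n)
    {G : Ω → SimpleGraph (Vert (n + 1))} (hG : IsRandomTwistedHypercube μ (n + 1) G) :
    μ {ω | ¬ ∀ φ : G ω ≃g G ω, φ = SimpleGraph.Iso.refl} ≤ ENNReal.ofReal (3 / 2 ^ n) := by
  obtain ⟨G₀, G₁, σ, h₀, h₁, hσ, hunif, hind, h⟩ := hG
  have hX : Measurable fun ω => (G₀ ω, G₁ ω) :=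
    Measurable.prodMk (fun S _ => h₀.measurableSet_preimage S)
      (fun S _ => h₁.measurableSet_preimage S)
  have hsub : {ω | ¬ ∀ φ : G ω ≃g G ω, φ = SimpleGraph.Iso.refl} ⊆
      {ω | σ ω ∈ badPerms (G₀ ω, G₁ ω).1 (G₀ ω, G₁ ω).2} := by
    intro ω hω
    by_contra hcon
    refine hω ?_
    rw [h ω]
    intro φ
    by_contra hφ
    refine hcon ⟨φ, ?_⟩
    by_contra hp
    push Not at hp
    exact hφ (RelIso.ext hp)
  have hsing : MeasurableSingletonClass (SimpleGraph (Vert n)) :=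
    ⟨fun g => measurableSet_simpleGraph {g}⟩
  refine (measure_mono hsub).trans (measure_mem_le_of_indepFun hX hind
    (fun q => badPerms q.1 q.2) (fun _ => trivial) fun ω => ?_)
  classical
  rw [← Measure.map_apply hσ trivial, hunif, uniformOn_univ,
    Measure.count_apply_finite _ (Set.toFinite _), ← Set.ncard_eq_toFinset_card,
    ← Nat.card_eq_fintype_card, Nat.card_perm]
  have hb := ncard_badPerms_le hn (h₀.isTwistedHypercube ω) (h₁.isTwistedHypercube ω)
  have hf : (0 : ℝ) < ((Nat.card (Vert n)).factorial : ℝ) := by positivity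
  have hb' : ((badPerms (G₀ ω) (G₁ ω)).ncard : ℝ) / ((Nat.card (Vert n)).factorial : ℝ) ≤
      3 / 2 ^ n := by
    rw [div_le_div_iff₀ hf (by positivity)]
    exact_mod_cast hb
  refine le_trans (le_of_eq ?_) (ENNReal.ofReal_le_ofReal hb')
  rw [ENNReal.ofReal_div_of_pos hf, ENNReal.ofReal_natCast, ENNReal.ofReal_natCast]

lemma abs_real_sub_one_le {Ω : Type*} [MeasurableSpace Ω] {μ : Measure Ω}
    [IsProbabilityMeasure μ] {n : ℕ} {G : Ω → SimpleGraph (Vert n)}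
    (hG : IsRandomTwistedHypercube μ n G) :
    |μ.real {ω | ∀ φ : G ω ≃g G ω, φ = SimpleGraph.Iso.refl} - 1| =
      μ.real {ω | ¬ ∀ φ : G ω ≃g G ω, φ = SimpleGraph.Iso.refl} := by
  have hm : MeasurableSet {ω | ∀ φ : G ω ≃g G ω, φ = SimpleGraph.Iso.refl} :=
    hG.measurableSet_preimage {g | ∀ φ : g ≃g g, φ = SimpleGraph.Iso.refl}
  have hc : {ω | ¬ ∀ φ : G ω ≃g G ω, φ = SimpleGraph.Iso.refl} =
      {ω | ∀ φ : G ω ≃g G ω, φ = SimpleGraph.Iso.refl}ᶜ := rfl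
  rw [hc, probReal_compl_eq_one_sub hm, abs_sub_comm, abs_of_nonneg]
  linarith [measureReal_le_one (μ := μ)
    (s := {ω | ∀ φ : G ω ≃g G ω, φ = SimpleGraph.Iso.refl})]

end TwistedHypercube

theorem mainTheorem3 :
    ∃ C : ℝ, 0 < C ∧
      ∀ (n : ℕ) (Ω : Type*) [MeasurableSpace Ω] (μ : Measure Ω) [IsProbabilityMeasure μ]
        (G : Ω → SimpleGraph (TwistedHypercube.Vert n)),
        TwistedHypercube.IsRandomTwistedHypercube μ n G →
        |μ.real {ω | ∀ φ : G ω ≃g G ω, φ = SimpleGraph.Iso.refl} - 1|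
          ≤ C * ((n : ℝ) ^ 2 * (2 : ℝ) ^ (-(n : ℝ) / 20)) := by
  -- `3 / 2 ^ n = 6 * 2 ^ (-(n + 1))` for large generations; for generations up to `12` the factor
  -- `2 ^ (-(n + 1) / 20)` is at least `1 / 2`, so the bound exceeds `1`.
  refine ⟨6, by norm_num, fun n Ω _ μ _ G hG => ?_⟩
  rw [TwistedHypercube.abs_real_sub_one_le hG]
  rcases n with _ | n
  -- In generation `0` the right side vanishes, so the event must be null.
  · have h0 : {ω | ¬ ∀ φ : G ω ≃g G ω, φ = SimpleGraph.Iso.refl} = ∅ := by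
      ext ω
      simp only [Set.mem_ofPred_eq, Set.mem_empty_iff_false, iff_false, not_not]
      intro φ
      have : Subsingleton (TwistedHypercube.Vert 0) := inferInstanceAs (Subsingleton Unit)
      exact RelIso.ext fun x => Subsingleton.elim _ _
    rw [h0]
    simp
  have hn1 : (1 : ℝ) ≤ ((n + 1 : ℕ) : ℝ) ^ 2 := by
    push_cast
    nlinarith [(Nat.cast_nonneg n : (0 : ℝ) ≤ n)]
  have hpos : (0 : ℝ) < (2 : ℝ) ^ (-((n + 1 : ℕ) : ℝ) / 20) := by positivity
  have hred : (2 : ℝ) ^ (-((n + 1 : ℕ) : ℝ) / 20) ≤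
      ((n + 1 : ℕ) : ℝ) ^ 2 * (2 : ℝ) ^ (-((n + 1 : ℕ) : ℝ) / 20) :=
    le_mul_of_one_le_left hpos.le hn1
  rcases lt_or_ge n 12 with hn | hn
  · have h1 : (2 : ℝ) ^ (-1 : ℝ) ≤ (2 : ℝ) ^ (-((n + 1 : ℕ) : ℝ) / 20) := by
      refine Real.rpow_le_rpow_of_exponent_le (by norm_num) ?_
      have : (n : ℝ) < 12 := by exact_mod_cast hn
      push_cast
      linarith
    rw [Real.rpow_neg_one] at h1
    have h2 := measureReal_le_one (μ := μ)
      (s := {ω | ¬ ∀ φ : G ω ≃g G ω, φ = SimpleGraph.Iso.refl})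
    linarith
  · have h1 : μ.real {ω | ¬ ∀ φ : G ω ≃g G ω, φ = SimpleGraph.Iso.refl} ≤ 3 / 2 ^ n :=
      ENNReal.toReal_le_of_le_ofReal (by positivity)
        (TwistedHypercube.measure_exists_aut_le hn hG)
    have h2 : (3 : ℝ) / 2 ^ n = 6 * (2 : ℝ) ^ (-((n + 1 : ℕ) : ℝ)) := by
      rw [Real.rpow_neg (by norm_num), Real.rpow_natCast, pow_succ]
      field_simp
      norm_num
    have h3 : (2 : ℝ) ^ (-((n + 1 : ℕ) : ℝ)) ≤ (2 : ℝ) ^ (-((n + 1 : ℕ) : ℝ) / 20) := by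
      refine Real.rpow_le_rpow_of_exponent_le (by norm_num) ?_
      have : (0 : ℝ) ≤ ((n + 1 : ℕ) : ℝ) := Nat.cast_nonneg _
      linarith
    rw [h2] at h1
    linarith
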